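/- Let $\mathcal{G}$ be a simple graph with countable vertex set $I$ and edge set $E$, and let $\le$ be a perfect elimination ordering on $I$: a total order such that for every $j\in I$ the subgraph induced on the set $\mathcal{G}_j=\{r\in I : r<j,\ \{r,j\}\in E\}\cup\{j\}$ is a finite complete graph. Let $W_{\mathcal{G}}$ be the right-angled Coxeter group with generators $s_i$ $(i\in I)$ and relations $s_i^2=1$ for all $i\in I$ and $s_is_j=s_js_i$ for all distinct $i,j$ with $\{i,j\}\notin E$. For $w\in W_{\mathcal{G}}$ with a reduced expression $w=s_{i_1}\cdots s_{i_k}$ put $\mathbf{x}(w)=x_{i_1}\cdots x_{i_k}$ (this does not depend on the reduced expression), and let $\mathcal{H}_{\mathcal{G}}(\mathbf{x})=\sum_{w\in W_{\mathcal{G}}}\mathbf{x}(w)$ be the Hilbert series. For a finitely supported tuple $\mathbf{m}=(m_i)_{i\in I}$ of non-negative integers let $|\mathbf{m}|=\sum_i m_i$, $\mathrm{supp}(\mathbf{m})=\{i : m_i\ne 0\}$, and let $S(\mathbf{m})$ be the set of all tuples $\boldsymbol{\lambda}=(\boldsymbol{\lambda}_i)_{i\in I}$ in which $\boldsymbol{\lambda}_i$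 is a partition of $m_i$. For a partition $\lambda$ let $\ell(\lambda)$ be its number of parts and $d_k^{\lambda}$ the number of its parts equal to $k$. Then $$\mathcal{H}_{\mathcal{G}}(\mathbf{x})=\sum_{\mathbf{m}}\left(\sum_{\boldsymbol{\lambda}\in S(\mathbf{m})}(-1)^{|\mathbf{m}|+\sum_{j\in\mathrm{supp}(\mathbf{m})}\ell(\boldsymbol{\lambda}_j)}\prod_{j\in\mathrm{supp}(\mathbf{m})}\binom{\sum_{i\in\mathcal{G}_j}\ell(\boldsymbol{\lambda}_i)}{\ell(\boldsymbol{\lambda}_j)}\frac{\ell(\boldsymbol{\lambda}_j)!}{\prod_{k\ge1}d_k^{\boldsymbol{\lambda}_j}!}\right)\mathbf{x}^{\mathbf{m}},$$ where the outer sum is over all finitely supported tuples $\mathbf{m}$ of non-negative integers. -/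

import Mathlib

namespace RACG

/-! ### Graphs with a perfect elimination ordering -/

/-- The vertex set of `G_k`: the vertex `k` together with its neighbours that precede it. -/
def earlier {I : Type*} [LinearOrder I] (G : SimpleGraph I) (k : I) : Set I :=
  {r : I | G.Adj r k ∧ r < k} ∪ {k}

/-- The given total order on the vertices is a perfect elimination ordering: every `G_k` is a
finite complete subgraph. -/
structure IsPerfectEliminationOrdering {I : Type*} [LinearOrder I] (G : SimpleGraph I) :
    Prop where
  finite (k : I) : (earlier G k).Finite
  isClique (k : I) : G.IsClique (earlier G k)

/-! ### The right-angled Coxeter group of a graph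

Two distinct generators commute exactly when the vertices are *not* adjacent. -/

open Classical in
/-- The Coxeter matrix of the right-angled Coxeter group of `G`; in Mathlib the entry `0` stands
for `∞`, that is, for the absence of a relation. -/
noncomputable def coxeterMatrix {I : Type*} (G : SimpleGraph I) : CoxeterMatrix I where
  M := Matrix.of fun i j => if i = j then 1 else if G.Adj i j then 0 else 2
  isSymm := by
    ext i j
    simp [Matrix.transpose_apply, eq_comm, G.adj_comm]
  diagonal i := by simp
  off_diagonal i j h := by
    simp only [Matrix.of_apply, if_neg h]
    split_ifs <;> simp

/-- The right-angled Coxeter group `W_G`: generators `s_i`, relations `s_i ^ 2 = 1` for all `i` and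
`(s_i s_j) ^ 2 = 1` for distinct non-adjacent `i`, `j`. -/
abbrev CoxGroup {I : Type*} (G : SimpleGraph I) : Type _ := (coxeterMatrix G).Group

/-- The Coxeter system of `W_G` with generators `s_i`. -/
noncomputable def system {I : Type*} (G : SimpleGraph I) :
    CoxeterSystem (coxeterMatrix G) (CoxGroup G) :=
  (coxeterMatrix G).toCoxeterSystem

/-- The exponent of the monomial `x_{i_1} ⋯ x_{i_k}` of the word `i_1 ⋯ i_k`. -/
noncomputable def wordDegree {I : Type*} (ω : List I) : I →₀ ℕ :=
  (ω.map fun i => Finsupp.single i 1).sum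

/-- The exponent of the monomial `x(w) = x_{i_1} ⋯ x_{i_k}`, where `w = s_{i_1} ⋯ s_{i_k}` is a
reduced expression; it does not depend on the reduced expression, see `degree_wordProd`. -/
noncomputable def degree {I : Type*} (G : SimpleGraph I) (w : CoxGroup G) : I →₀ ℕ :=
  wordDegree ((system G).exists_isReduced w).choose

/-- The Hilbert series `∑ x(w)`, the sum over all `w` in `W_G`: its coefficient at `x ^ m` is the
number (finite by `finite_degree_eq`) of elements `w` with `x(w) = x ^ m`. -/
noncomputable def hilbertSeries {I : Type*} (G : SimpleGraph I) : MvPowerSeries I ℂ :=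
  fun m => (Nat.card {w : CoxGroup G // degree G w = m} : ℂ)

/-! ### Tuples of partitions -/

/-- `S(m)`: the tuples `(λ_i)` in which `λ_i` is a partition of `m_i`. -/
abbrev PartitionTuple {I : Type*} (m : I →₀ ℕ) : Type _ := ∀ i : I, Nat.Partition (m i)

/-- The length `ℓ(λ)` of a partition, that is, its number of parts. -/
def length {n : ℕ} (p : Nat.Partition n) : ℕ := p.parts.card

/-- `∏_{k ≥ 1} d_k!`, where `d_k` is the number of parts of the partition equal to `k`; a partition
of `n` has no parts exceeding `n`. -/
def multFactorial {n : ℕ} (p : Nat.Partition n) : ℕ :=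
  ∏ k ∈ Finset.Icc 1 n, Nat.factorial (p.parts.count k)

instance partitionTupleFinite {I : Type*} (m : I →₀ ℕ) : Finite (PartitionTuple m) := by
  refine Finite.of_injective
    (fun (l : PartitionTuple m) (i : m.support) => l i.1) fun l l' h => ?_
  funext i
  by_cases hi : m i = 0
  · have : ∀ n : ℕ, n = 0 → ∀ p q : Nat.Partition n, p = q := by
      rintro n rfl p q
      exact Subsingleton.elim _ _
    exact this _ hi _ _
  · exact congrFun h ⟨i, by simpa using hi⟩

noncomputable instance partitionTupleFintype {I : Type*} (m : I →₀ ℕ) : Fintype (PartitionTuple m) :=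
  Fintype.ofFinite _

/-! ### The monomial of a group element is well defined -/

theorem wordDegree_apply {I : Type*} [DecidableEq I] (ω : List I) (j : I) :
    wordDegree ω j = ω.count j := by
  induction ω with
  | nil => simp [wordDegree]
  | cons i ω ih =>
    have : wordDegree (i :: ω) = Finsupp.single i 1 + wordDegree ω := by simp [wordDegree]
    rw [this, Finsupp.add_apply, ih, List.count_cons, Finsupp.single_apply]
    simp [add_comm]

/-- The exponents of `x(w)` are determined by `w` modulo 2. -/
theorem count_mod_two {I : Type*} [DecidableEq I] (G : SimpleGraph I) (j : I) {ω τ : List I}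
    (h : (system G).wordProd ω = (system G).wordProd τ) :
    (ω.count j : ZMod 2) = τ.count j := by
  have two : ∀ a : ZMod 2, a + a = 0 := by decide
  have hl : (coxeterMatrix G).IsLiftable
      (fun i => Multiplicative.ofAdd (if i = j then (1 : ZMod 2) else 0)) := by
    intro a b
    rw [← ofAdd_add, ← ofAdd_nsmul, ← ofAdd_zero]
    congr 1
    by_cases hab : a = b
    · subst hab
      rw [two, smul_zero]
    · by_cases hadj : G.Adj a b
      · have : coxeterMatrix G a b = 0 := by simp [coxeterMatrix, hab, hadj]
        rw [this, zero_smul]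
      · have : coxeterMatrix G a b = 2 := by simp [coxeterMatrix, hab, hadj]
        rw [this, two_nsmul, two]
  have key : ∀ ω : List I, (system G).lift ⟨_, hl⟩ ((system G).wordProd ω) =
      Multiplicative.ofAdd (ω.count j : ZMod 2) := by
    intro ω
    induction ω with
    | nil => simp
    | cons i ω ih =>
      rw [CoxeterSystem.wordProd_cons, map_mul, ih, CoxeterSystem.lift_apply_simple,
        List.count_cons, ← ofAdd_add]
      by_cases hij : i = j <;> simp [hij, add_comm]
  have := key ω
  rw [h, key τ] at this
  exact (Multiplicative.ofAdd.injective this).symm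

open Classical in
/-- The involution `(t, ε) ↦ (s_i t s_i, ε + [t = s_i])`. -/
noncomputable def signFlip {I : Type*} (G : SimpleGraph I) (i : I) :
    CoxGroup G × ZMod 2 → CoxGroup G × ZMod 2 :=
  fun p => ((system G).simple i * p.1 * (system G).simple i,
    p.2 + if p.1 = (system G).simple i then 1 else 0)

theorem signFlip_mk {I : Type*} (G : SimpleGraph I) (i : I) (t : CoxGroup G) (e : ZMod 2)
    [Decidable (t = (system G).simple i)] :
    signFlip G i (t, e) = ((system G).simple i * t * (system G).simple i,
      e + if t = (system G).simple i then 1 else 0) := by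
  simp only [signFlip]
  congr

theorem signFlip_signFlip {I : Type*} (G : SimpleGraph I) (i : I) (p : CoxGroup G × ZMod 2) :
    signFlip G i (signFlip G i p) = p := by
  classical
  have two : ∀ a : ZMod 2, a + a = 0 := by decide
  obtain ⟨t, e⟩ := p
  have h : (system G).simple i * t * (system G).simple i = (system G).simple i ↔
      t = (system G).simple i := by
    constructor
    · intro h
      have := congrArg (fun x => (system G).simple i * x * (system G).simple i) h
      simpa [mul_assoc] using this
    · rintro rfl
      simp
  rw [signFlip_mk, signFlip_mk]
  ext
  · simp [mul_assoc]
  · change (e + _) + _ = e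
    rw [if_congr h rfl rfl, add_assoc, two, add_zero]

theorem signFlip_comm {I : Type*} (G : SimpleGraph I) {i j : I} (hij : i ≠ j) (hadj : ¬ G.Adj i j)
    (p : CoxGroup G × ZMod 2) : signFlip G i (signFlip G j p) = signFlip G j (signFlip G i p) := by
  classical
  obtain ⟨t, e⟩ := p
  have hm : coxeterMatrix G i j = 2 := by simp [coxeterMatrix, hij, hadj]
  have hc : (system G).simple i * (system G).simple j =
      (system G).simple j * (system G).simple i := by
    have := (system G).simple_mul_simple_pow i j
    rw [hm, pow_two] at this
    have h2 := eq_inv_of_mul_eq_one_left this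
    simpa using h2
  have aux : ∀ a b : CoxGroup G, a * a = 1 → a * b = b * a → (a * t * a = b ↔ t = b) := by
    intro a b ha hab
    constructor
    · intro h
      have h2 : a * (a * t * a) * a = t := by
        rw [← mul_assoc, ← mul_assoc, ha, one_mul, mul_assoc, ha, mul_one]
      rw [← h2, h, hab, mul_assoc, ha, mul_one]
    · rintro rfl
      rw [hab, mul_assoc, ha, mul_one]
  rw [signFlip_mk, signFlip_mk, signFlip_mk, signFlip_mk]
  ext
  · simp only [← mul_assoc]
    rw [hc]
    simp only [mul_assoc]
    rw [hc]
  · change (e + _) + _ = (e + _) + _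
    rw [if_congr (aux _ _ ((system G).simple_mul_simple_self j) hc.symm) rfl rfl,
      if_congr (aux _ _ ((system G).simple_mul_simple_self i) hc) rfl rfl, add_right_comm]

/-- The action of `W_G` generated by the involutions `signFlip`. -/
theorem exists_signFlipHom {I : Type*} (G : SimpleGraph I) :
    ∃ φ : CoxGroup G →* Function.End (CoxGroup G × ZMod 2),
      ∀ i, φ ((system G).simple i) = signFlip G i := by
  have hl : CoxeterMatrix.IsLiftable (G := Function.End (CoxGroup G × ZMod 2)) (coxeterMatrix G)
      (signFlip G) := by
    intro i j
    by_cases hij : i = j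
    · subst hij
      rw [(coxeterMatrix G).diagonal, pow_one]
      funext p
      exact signFlip_signFlip G i p
    · by_cases hadj : G.Adj i j
      · have : coxeterMatrix G i j = 0 := by simp [coxeterMatrix, hij, hadj]
        rw [this, pow_zero]
      · have : coxeterMatrix G i j = 2 := by simp [coxeterMatrix, hij, hadj]
        rw [this, pow_two]
        funext p
        change signFlip G i (signFlip G j (signFlip G i (signFlip G j p))) = p
        rw [signFlip_comm G hij hadj (signFlip G i (signFlip G j p)), signFlip_signFlip, signFlip_signFlip]
  exact ⟨(system G).lift ⟨_, hl⟩, fun i => CoxeterSystem.lift_apply_simple _ hl i⟩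

open Classical in
/-- The parity with which an element occurs in the left inversion sequence of a word depends only
on the product of the word. -/
theorem count_leftInvSeq_mod_two {I : Type*} (G : SimpleGraph I) {ω τ : List I}
    (h : (system G).wordProd ω = (system G).wordProd τ) (t : CoxGroup G) :
    (((system G).leftInvSeq ω).count t : ZMod 2) = ((system G).leftInvSeq τ).count t := by
  obtain ⟨φ, hφ⟩ := exists_signFlipHom G
  have key : ∀ (ω : List I) (t : CoxGroup G) (e : ZMod 2),
      (φ ((system G).wordProd ω)⁻¹ (t, e)).2 =
        e + (((system G).leftInvSeq ω).count t : ZMod 2) := by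
    intro ω
    induction ω with
    | nil =>
      intro t e
      rw [CoxeterSystem.wordProd_nil, inv_one, map_one]
      change e = _
      simp
    | cons i ω ih =>
      intro t e
      have h1 : φ ((system G).wordProd (i :: ω))⁻¹ (t, e) =
          φ ((system G).wordProd ω)⁻¹ (signFlip G i (t, e)) := by
        rw [CoxeterSystem.wordProd_cons, mul_inv_rev, map_mul, CoxeterSystem.inv_simple, hφ]
        rfl
      rw [h1]
      simp only [signFlip]
      rw [ih, CoxeterSystem.leftInvSeq, List.count_cons]
      have h2 : t = MulAut.conj ((system G).simple i)
          ((system G).simple i * t * (system G).simple i) := by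
        simp [mul_assoc]
      have h3 := List.count_map_of_injective ((system G).leftInvSeq ω)
        (MulAut.conj ((system G).simple i)) (MulEquiv.injective _)
        ((system G).simple i * t * (system G).simple i)
      rw [← h2] at h3
      rw [h3]
      by_cases hts : t = (system G).simple i
      · simp [hts, add_assoc, add_comm]
      · simp [hts, Ne.symm hts]
  have h1 := key ω t 0
  rw [h, key τ t 0] at h1
  simpa using h1.symm

/-- Two reduced expressions of the same element have the same monomial. -/
theorem wordDegree_eq {I : Type*} (G : SimpleGraph I) : ∀ (ω τ : List I),
    (system G).IsReduced ω → (system G).IsReduced τ →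
    (system G).wordProd ω = (system G).wordProd τ → wordDegree ω = wordDegree τ := by
  classical
  intro ω
  induction ω with
  | nil =>
    intro τ _ hτ h
    have : τ.length = 0 := by rw [← hτ.eq, ← h]; simp
    rw [List.length_eq_zero_iff.mp this]
  | cons i ω ih =>
    intro τ hω hτ h
    have hlen : (i :: ω).length = τ.length := by rw [← hω.eq, ← hτ.eq, h]
    have hω' : (system G).IsReduced ω := by simpa using hω.drop 1
    have hmem : (system G).simple i ∈ (system G).leftInvSeq τ := by
      have h1 : ((system G).leftInvSeq (i :: ω)).count ((system G).simple i) = 1 :=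
        List.count_eq_one_of_mem hω.nodup_leftInvSeq (by simp [CoxeterSystem.leftInvSeq])
      have h2 := count_leftInvSeq_mod_two G h ((system G).simple i)
      rw [h1] at h2
      by_contra hn
      rw [List.count_eq_zero_of_not_mem hn] at h2
      simp at h2
    obtain ⟨k, hk, hke⟩ := List.getElem_of_mem hmem
    have hk' : k < τ.length := by simpa using hk
    have hprod : (system G).wordProd ω = (system G).wordProd (τ.eraseIdx k) := by
      have h1 := (system G).getD_leftInvSeq_mul_wordProd τ k
      rw [List.getD_eq_getElem _ _ hk, hke, ← h, CoxeterSystem.wordProd_cons,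
        CoxeterSystem.simple_mul_simple_cancel_left] at h1
      exact h1
    have hel : (τ.eraseIdx k).length = ω.length := by
      rw [List.length_eraseIdx_of_lt hk', ← hlen]; simp
    have hered : (system G).IsReduced (τ.eraseIdx k) := by
      rw [CoxeterSystem.IsReduced, ← hprod, hω'.eq, hel]
    have hdeg := ih _ hω' hered hprod
    have hperm := (List.getElem_cons_eraseIdx_perm hk').symm
    ext j
    have hj := DFunLike.congr_fun hdeg j
    have hmod := count_mod_two G j h
    rw [wordDegree_apply, wordDegree_apply] at *
    rw [hperm.count_eq j] at hmod ⊢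
    rw [List.count_cons, List.count_cons] at *
    rw [hj] at hmod ⊢
    by_cases h1 : i = j <;> by_cases h2 : τ[k] = j <;> simp [h1, h2] at hmod ⊢

/-- `x(w)` can be computed from any reduced expression of `w`. -/
theorem degree_wordProd {I : Type*} (G : SimpleGraph I) (ω : List I)
    (hω : (system G).IsReduced ω) : degree G ((system G).wordProd ω) = wordDegree ω := by
  have h := ((system G).exists_isReduced ((system G).wordProd ω)).choose_spec
  exact wordDegree_eq G _ _ h.1 hω h.2.symm

/-- Only finitely many elements have a given monomial. -/
theorem finite_degree_eq {I : Type*} (G : SimpleGraph I) (m : I →₀ ℕ) :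
    Finite {w : CoxGroup G // degree G w = m} := by
  classical
  have hfin : {ω : List I | (ω : Multiset I) = Finsupp.toMultiset m}.Finite := by
    obtain ⟨l, hl⟩ := Quot.exists_rep (Finsupp.toMultiset m)
    refine (List.finite_toSet l.permutations).subset fun ω h => ?_
    rw [Set.mem_ofPred_eq, ← hl] at h
    exact List.mem_permutations.mpr (Multiset.coe_eq_coe.mp h)
  refine ((hfin.image (system G).wordProd).subset ?_).to_subtype
  intro w hw
  refine ⟨_, ?_, ((system G).exists_isReduced w).choose_spec.2.symm⟩
  ext j
  have h := DFunLike.congr_fun (show degree G w = m from hw) j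
  rw [degree, wordDegree_apply] at h
  rw [Finsupp.count_toMultiset, ← h, Multiset.coe_count]

end RACG

namespace RACG

/-! ### Left descents -/

section Descents

variable {I : Type*} (G : SimpleGraph I)

/-! Let `H_S` be the generating series of the elements whose left descents include `S`, so that
`H_∅` is the Hilbert series. Multiplication by `s_i` gives `(1 + x_i) H_{S ∪ {i}} = x_i H_S`
whenever `i ∉ S` and `S ∪ {i}` is independent (`descentCount_insert`). Left descents are pairwise
non-adjacent, because two adjacent generators span an infinite dihedral group
(`not_adj_of_isLeftDescent`). Hence inclusion-exclusion over descent sets gives `∑_S (-1)^|S| H_S =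
1`, the sum over finite independent `S` (`sum_neg_one_pow_descentCount`). With `y_i = x_i / (1 +
x_i)` this says that the Hilbert series is the inverse of `∑_S (-1)^|S| y^S`.

The ordering serves to invert that series: its inverse is `B(y) = ∑_n ∏_j binom(∑_{i ∈ G_j} n_i,
n_j) y^n` (`sum_neg_one_pow_loweredBinomialProduct`). This follows by removing the largest vertex
`j`: as `G_j` is a clique, an independent set meets it at most once, and Pascal's rule does the
rest.

No series is divided. The families `H_S` and `y^S B(y)`, expanded in `x`, satisfy the same recursion
on coefficients, which has only one solution (`eq_of_recursion`). Finally, the coefficient of `x^m`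
in `y^n` is a product of signed numbers of compositions of `m_j` into `n_j` parts; grouping
compositions by their underlying partition produces the multinomial factors (`substCoeff_eq_sum`).
-/

theorem simple_injective : Function.Injective (system G).simple := by
  classical
  intro i j h
  by_contra hij
  have h1 := count_mod_two G j (ω := [i]) (τ := [j]) (by simpa using h)
  simp [hij] at h1

theorem simple_mul_simple_comm {i j : I} (hadj : ¬ G.Adj i j) :
    (system G).simple i * (system G).simple j = (system G).simple j * (system G).simple i := by
  rcases eq_or_ne i j with rfl | hij
  · rfl
  have hm : coxeterMatrix G i j = 2 := by simp [coxeterMatrix, hij, hadj]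
  have := (system G).simple_mul_simple_pow i j
  rw [hm, pow_two] at this
  have h2 := eq_inv_of_mul_eq_one_left this
  simpa using h2

theorem isReduced_cons {i : I} {ω : List I} (hω : (system G).IsReduced ω)
    (hi : ¬ (system G).IsLeftDescent ((system G).wordProd ω) i) :
    (system G).IsReduced (i :: ω) := by
  rw [CoxeterSystem.IsReduced, CoxeterSystem.wordProd_cons,
    (system G).not_isLeftDescent_iff.mp hi, hω.eq, List.length_cons]

theorem exists_isReduced_cons {w : CoxGroup G} {i : I} (hi : (system G).IsLeftDescent w i) :
    ∃ ω, (system G).IsReduced ω ∧ (system G).simple i * w = (system G).wordProd ω ∧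
      (system G).IsReduced (i :: ω) ∧ w = (system G).wordProd (i :: ω) := by
  obtain ⟨ω, hω, hw⟩ := (system G).exists_isReduced ((system G).simple i * w)
  refine ⟨ω, hω, hw, isReduced_cons G hω ?_, ?_⟩
  · rw [← hw]
    exact (system G).isLeftDescent_iff_not_isLeftDescent_mul.mp hi
  · rw [CoxeterSystem.wordProd_cons, ← hw, CoxeterSystem.simple_mul_simple_cancel_left]

open Classical in
/-- A generator is a left descent exactly when it occurs an odd number of times in the left
inversion sequence of a word. -/
theorem isLeftDescent_iff_count (ω : List I) (i : I) :
    (system G).IsLeftDescent ((system G).wordProd ω) i ↔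
      (((system G).leftInvSeq ω).count ((system G).simple i) : ZMod 2) = 1 := by
  constructor
  · intro h
    -- In a reduced word starting with `i`, the entry `s_i` occurs exactly once in the inversion
    -- sequence; the parity passes to any other word for the same element.
    obtain ⟨τ, -, -, hτ, hw⟩ := exists_isReduced_cons G h
    rw [count_leftInvSeq_mod_two G hw,
      List.count_eq_one_of_mem hτ.nodup_leftInvSeq (by simp [CoxeterSystem.leftInvSeq]),
      Nat.cast_one]
  · intro h
    obtain ⟨τ, hτ, hw⟩ := (system G).exists_isReduced ((system G).wordProd ω)
    rw [count_leftInvSeq_mod_two G hw] at h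
    rw [hw]
    have hmem : (system G).simple i ∈ (system G).leftInvSeq τ := by
      by_contra hn
      rw [List.count_eq_zero_of_not_mem hn] at h
      simp at h
    simpa using (system G).isLeftInversion_of_mem_leftInvSeq hτ hmem

theorem mem_leftInvSeq_of_isLeftDescent {ω : List I} {i : I}
    (h : (system G).IsLeftDescent ((system G).wordProd ω) i) :
    (system G).simple i ∈ (system G).leftInvSeq ω := by
  classical
  rw [isLeftDescent_iff_count] at h
  by_contra hn
  rw [List.count_eq_zero_of_not_mem hn] at h
  simp at h

/-- Left multiplication by a commuting generator preserves left descents. -/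
theorem isLeftDescent_simple_mul {w : CoxGroup G} {i k : I} (hik : i ≠ k) (hadj : ¬ G.Adj i k) :
    (system G).IsLeftDescent ((system G).simple i * w) k ↔ (system G).IsLeftDescent w k := by
  classical
  obtain ⟨ω, -, rfl⟩ := (system G).exists_isReduced w
  rw [← CoxeterSystem.wordProd_cons, isLeftDescent_iff_count, isLeftDescent_iff_count,
    CoxeterSystem.leftInvSeq, List.count_cons_of_ne (fun h => hik (simple_injective G h))]
  -- Prefixing `i` conjugates the inversion sequence by `s_i`, which fixes `s_k`, and adds only `s_i
  -- ≠ s_k`; the count of `s_k` is unchanged.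
  have h2 : (system G).simple k = MulAut.conj ((system G).simple i) ((system G).simple k) := by
    rw [MulAut.conj_apply, simple_mul_simple_comm G hadj, mul_inv_cancel_right]
  conv_lhs => rw [h2]
  rw [List.count_map_of_injective _ _ (MulEquiv.injective _)]

/-- The alternating word `i k i ⋯` of length `r`. -/
def alternating : ℕ → I → I → List I
  | 0, _, _ => []
  | r + 1, i, k => i :: alternating r k i

theorem length_alternating (r : ℕ) (i k : I) : (alternating r i k).length = r := by
  induction r generalizing i k with
  | zero => rfl
  | succ r ih => simp [alternating, ih]

/-- For adjacent `i` and `k`, the action of `W_G` on `ℤ` through the infinite dihedral group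
generated by `s_i` and `s_k`. -/
theorem exists_dihedralHom {i k : I} (hik : G.Adj i k) :
    ∃ φ : CoxGroup G →* Equiv.Perm ℤ, φ ((system G).simple k) = Equiv.subLeft 0 ∧
      φ ((system G).simple i) = Equiv.subLeft 1 := by
  classical
  have hne : i ≠ k := hik.ne
  -- `s_k` and `s_i` act as the reflections `x ↦ -x` and `x ↦ 1 - x`, all other generators
  -- trivially.
  let f : I → Equiv.Perm ℤ := fun l =>
    if l = k then Equiv.subLeft 0 else if l = i then Equiv.subLeft 1 else 1
  have hf : ∀ l, f l * f l = 1 := by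
    intro l
    ext x
    simp only [f]
    split_ifs <;> simp
  have hl : (coxeterMatrix G).IsLiftable f := by
    intro a b
    by_cases hab : a = b
    · subst hab
      rw [hf, one_pow]
    · by_cases hadj : G.Adj a b
      · have : coxeterMatrix G a b = 0 := by simp [coxeterMatrix, hab, hadj]
        rw [this, pow_zero]
      · have : coxeterMatrix G a b = 2 := by simp [coxeterMatrix, hab, hadj]
        rw [this]
        -- The only pair with both images nontrivial is `{i, k}`, which is adjacent and so carries
        -- no relation.
        have h1 : f a = 1 ∨ f b = 1 := by
          by_contra! h
          simp only [f] at h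
          have ha : a = k ∨ a = i := by
            by_contra! ha
            simp [ha.1, ha.2] at h
          have hb : b = k ∨ b = i := by
            by_contra! hb
            simp [hb.1, hb.2] at h
          rcases ha with rfl | rfl <;> rcases hb with rfl | rfl
          · exact hab rfl
          · exact hadj hik.symm
          · exact hadj hik
          · exact hab rfl
        rcases h1 with h1 | h1 <;> simp [h1, pow_two, hf]
  refine ⟨(system G).lift ⟨f, hl⟩, ?_, ?_⟩
  · exact (CoxeterSystem.lift_apply_simple _ hl k).trans (by simp [f])
  · exact (CoxeterSystem.lift_apply_simple _ hl i).trans (by simp [f, hne])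

theorem subLeft_conj (a c : ℤ) :
    (Equiv.subLeft a : Equiv.Perm ℤ) * Equiv.subLeft c * (Equiv.subLeft a)⁻¹ =
      Equiv.subLeft (2 * a - c) := by
  rw [mul_inv_eq_iff_eq_mul]
  ext x
  simp
  ring

/-- In the dihedral action every inversion of the word `k i k ⋯` is a reflection `x ↦ c - x` with `c
≤ 0`, whereas `s_i` has `c = 1`. -/
theorem simple_notMem_leftInvSeq_alternating {i k : I} (hik : G.Adj i k) (r : ℕ) :
    (system G).simple i ∉ (system G).leftInvSeq (alternating r k i) := by
  obtain ⟨φ, hk, hi⟩ := exists_dihedralHom G hik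
  -- The two alternating words are treated together: prefixing `k` replaces `c` by `-c` and
  -- prefixing `i` replaces `c` by `2 - c`, so the two sign conditions feed each other.
  have key : ∀ r, (∀ t ∈ (system G).leftInvSeq (alternating r k i),
      ∃ c ≤ 0, φ t = Equiv.subLeft c) ∧ (∀ t ∈ (system G).leftInvSeq (alternating r i k),
      ∃ c > 0, φ t = Equiv.subLeft c) := by
    intro r
    induction r with
    | zero => simp [alternating]
    | succ r ih =>
      constructor
      · intro t ht
        simp only [alternating, CoxeterSystem.leftInvSeq, List.mem_cons, List.mem_map] at ht
        rcases ht with rfl | ⟨u, hu, rfl⟩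
        · exact ⟨0, le_rfl, hk⟩
        · obtain ⟨c, hc, hu⟩ := ih.2 u hu
          refine ⟨2 * 0 - c, by lia, ?_⟩
          rw [MulAut.conj_apply, map_mul, map_mul, map_inv, hk, hu, subLeft_conj]
      · intro t ht
        simp only [alternating, CoxeterSystem.leftInvSeq, List.mem_cons, List.mem_map] at ht
        rcases ht with rfl | ⟨u, hu, rfl⟩
        · exact ⟨1, by simp, hi⟩
        · obtain ⟨c, hc, hu⟩ := ih.1 u hu
          refine ⟨2 * 1 - c, by lia, ?_⟩
          rw [MulAut.conj_apply, map_mul, map_mul, map_inv, hi, hu, subLeft_conj]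
  intro hmem
  obtain ⟨c, hc, h⟩ := (key r).1 _ hmem
  rw [hi] at h
  have := congrArg (fun e : Equiv.Perm ℤ => e 0) h
  simp at this
  lia

/-- An element with two adjacent left descents begins with alternating words of any length. -/
theorem exists_alternating_append {w : CoxGroup G} (r : ℕ) : ∀ {i k : I}, G.Adj i k →
    (system G).IsLeftDescent w i → (system G).IsLeftDescent w k →
    ∃ τ, (system G).IsReduced (alternating r i k ++ τ) ∧
      w = (system G).wordProd (alternating r i k ++ τ) := by
  induction r with
  | zero =>
    intro i k _ _ _
    exact (system G).exists_isReduced w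
  | succ r ih =>
    intro i k hik hi hk
    obtain ⟨τ, hτ, hw⟩ := ih hik.symm hk hi
    have hmem := mem_leftInvSeq_of_isLeftDescent G (hw ▸ hi)
    obtain ⟨q, hq, hqe⟩ := List.getElem_of_mem hmem
    have hq' : q < (alternating r k i ++ τ).length := by simpa using hq
    -- By the exchange property, prefixing `i` to `w` deletes one letter of the word; it cannot lie
    -- in the alternating prefix, which therefore survives and grows by `i`.
    have hrq : r ≤ q := by
      by_contra! hqr
      apply simple_notMem_leftInvSeq_alternating G hik r
      have h1 : (system G).leftInvSeq (alternating r k i) =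
          ((system G).leftInvSeq (alternating r k i ++ τ)).take r := by
        rw [← CoxeterSystem.leftInvSeq_take]
        congr 1
        rw [List.take_left' (length_alternating r k i)]
      rw [h1, ← hqe]
      exact List.mem_take_iff_getElem.mpr ⟨q, by simpa using ⟨hqr, by simpa using hq'⟩, rfl⟩
    have hprod := (system G).getD_leftInvSeq_mul_wordProd (alternating r k i ++ τ) q
    have her : (alternating r k i ++ τ).eraseIdx q =
        alternating r k i ++ τ.eraseIdx (q - r) := by
      rw [List.eraseIdx_append_of_length_le (by rw [length_alternating]; exact hrq),
        length_alternating]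
    rw [List.getD_eq_getElem _ _ hq, hqe, her] at hprod
    have hw' : w = (system G).wordProd (alternating (r + 1) i k ++ τ.eraseIdx (q - r)) := by
      rw [alternating, List.cons_append, CoxeterSystem.wordProd_cons, ← hprod,
        CoxeterSystem.simple_mul_simple_cancel_left, hw]
    refine ⟨_, ?_, hw'⟩
    rw [CoxeterSystem.IsReduced, ← hw', hw, hτ.eq, alternating, List.cons_append, List.length_cons,
      ← her, List.length_eraseIdx_of_lt hq']
    lia

/-- Left descents are pairwise non-adjacent. -/
theorem not_adj_of_isLeftDescent {w : CoxGroup G} {i k : I} (hi : (system G).IsLeftDescent w i)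
    (hk : (system G).IsLeftDescent w k) : ¬ G.Adj i k := by
  intro hik
  -- A reduced word cannot have a prefix longer than the length of its element.
  obtain ⟨τ, hτ, hw⟩ := exists_alternating_append G ((system G).length w + 1) hik hi hk
  have h := hτ.eq
  rw [← hw, List.length_append, length_alternating] at h
  lia

theorem degree_simple_mul_add {w : CoxGroup G} {i : I} (hi : (system G).IsLeftDescent w i) :
    degree G w = degree G ((system G).simple i * w) + Finsupp.single i 1 := by
  obtain ⟨ω, hω, hw, hω', hw'⟩ := exists_isReduced_cons G hi
  rw [hw, hw', degree_wordProd G _ hω, degree_wordProd G _ hω']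
  simp [wordDegree, add_comm]

theorem degree_simple_mul {w : CoxGroup G} {i : I} (hi : ¬ (system G).IsLeftDescent w i) :
    degree G ((system G).simple i * w) = degree G w + Finsupp.single i 1 := by
  have h := (system G).isLeftDescent_iff_not_isLeftDescent_mul (w := (system G).simple i * w)
    (i := i)
  rw [CoxeterSystem.simple_mul_simple_cancel_left] at h
  rw [degree_simple_mul_add G (h.mpr hi), CoxeterSystem.simple_mul_simple_cancel_left]

theorem degree_one : degree G 1 = 0 := by
  have := degree_wordProd G [] (by simp [CoxeterSystem.IsReduced])
  simpa [wordDegree] using this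

end Descents

/-! ### Counting group elements with prescribed descents -/

section DescentCount

variable {I : Type*} (G : SimpleGraph I)

/-- The elements with monomial `x ^ m` whose left descents include `S`. -/
def descentSet (S : Finset I) (m : I →₀ ℕ) : Set (CoxGroup G) :=
  {w | degree G w = m ∧ ∀ i ∈ S, (system G).IsLeftDescent w i}

/-- The number of elements with monomial `x ^ m` whose left descents include `S`. -/
noncomputable def descentCount (S : Finset I) (m : I →₀ ℕ) : ℂ := ((descentSet G S m).ncard : ℂ)

theorem finite_setOf_degree (m : I →₀ ℕ) : {w : CoxGroup G | degree G w = m}.Finite :=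
  Set.finite_coe_iff.mp (finite_degree_eq G m)

theorem finite_descentSet (S : Finset I) (m : I →₀ ℕ) : (descentSet G S m).Finite :=
  (finite_setOf_degree G m).subset fun _ hw => hw.1

theorem descentCount_empty (m : I →₀ ℕ) :
    descentCount G ∅ m = MvPowerSeries.coeff m (hilbertSeries G) := by
  rw [MvPowerSeries.coeff_apply, hilbertSeries, descentCount, ← Nat.card_coe_set_eq]
  simp [descentSet, Set.coe_ofPred]

theorem degree_apply_ne_zero {w : CoxGroup G} {i : I} (hi : (system G).IsLeftDescent w i) :
    degree G w i ≠ 0 := by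
  rw [degree_simple_mul_add G hi]
  simp

theorem descentCount_eq_zero {S : Finset I} {m : I →₀ ℕ} {i : I} (hi : i ∈ S) (hm : m i = 0) :
    descentCount G S m = 0 := by
  have : descentSet G S m = ∅ := by
    ext w
    simp only [descentSet, Set.mem_ofPred_eq, Set.mem_empty_iff_false, iff_false, not_and]
    rintro rfl h
    exact degree_apply_ne_zero G (h i hi) hm
  simp [descentCount, this]

/-- Left multiplication by `s_i` commutes with the generators in `S`, so it keeps those descents,
and it makes `i` a descent exactly when `i` was not one. It thus maps the elements of `descentSet G
S m` without descent `i` bijectively onto the first set counted. -/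
theorem descentCount_insert [DecidableEq I] {S : Finset I} {i : I} (hi : i ∉ S)
    (hS : G.IsIndepSet (insert i S : Finset I)) (m : I →₀ ℕ) :
    descentCount G (insert i S) (m + Finsupp.single i 1) + descentCount G (insert i S) m =
      descentCount G S m := by
  have hne : ∀ k ∈ S, i ≠ k := fun k hk h => hi (h ▸ hk)
  have hadj : ∀ k ∈ S, ¬ G.Adj i k := fun k hk => hS (by simp) (by simp [hk]) (hne k hk)
  have h1 : descentSet G (insert i S) (m + Finsupp.single i 1) =
      (fun w => (system G).simple i * w) '' (descentSet G S m \ descentSet G (insert i S) m) := by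
    ext w
    simp only [descentSet, Set.mem_ofPred_eq, Set.mem_image, Set.mem_sdiff, Finset.forall_mem_insert]
    constructor
    · rintro ⟨hd, hwi, hwS⟩
      have hi' := (system G).isLeftDescent_iff_not_isLeftDescent_mul.mp hwi
      refine ⟨(system G).simple i * w, ⟨⟨?_, ?_⟩, ?_⟩, by simp⟩
      · rw [degree_simple_mul_add G hwi] at hd
        exact add_right_cancel hd
      · intro k hk
        rw [isLeftDescent_simple_mul G (hne k hk) (hadj k hk)]
        exact hwS k hk
      · tauto
    · rintro ⟨v, ⟨⟨hd, hv⟩, hv'⟩, rfl⟩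
      have hvi : ¬ (system G).IsLeftDescent v i := by tauto
      refine ⟨by rw [degree_simple_mul G hvi, hd], ?_, ?_⟩
      · rw [(system G).isLeftDescent_iff_not_isLeftDescent_mul]
        simpa using hvi
      · intro k hk
        rw [isLeftDescent_simple_mul G (hne k hk) (hadj k hk)]
        exact hv k hk
  have hsub : descentSet G (insert i S) m ⊆ descentSet G S m :=
    fun w hw => ⟨hw.1, fun k hk => hw.2 k (by simp [hk])⟩
  rw [descentCount, descentCount, descentCount, h1,
    Set.ncard_image_of_injective _ (mul_right_injective _), ← Nat.cast_add,
    Set.ncard_sdiff_add_ncard_of_subset hsub (finite_descentSet G S m)]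

open Classical in
/-- The independent subsets of a finite set of vertices. -/
noncomputable def indepSubsets (A : Finset I) : Finset (Finset I) :=
  A.powerset.filter fun S => G.IsIndepSet (S : Set I)

theorem mem_indepSubsets {A S : Finset I} :
    S ∈ indepSubsets G A ↔ S ⊆ A ∧ G.IsIndepSet (S : Set I) := by
  simp [indepSubsets]

-- After exchanging the sums, each `w` contributes `∑ (-1)^|S|` over all subsets `S` of its descent
-- set: independence is automatic, and descents lie in the support of the monomial. This vanishes
-- unless there are no descents, that is, unless `w = 1`.
open Classical in
theorem sum_neg_one_pow_descentCount (m : I →₀ ℕ) :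
    ∑ S ∈ indepSubsets G m.support,
      (-1 : ℂ) ^ S.card * descentCount G S m = if m = 0 then 1 else 0 := by
  set F := (finite_setOf_degree G m).toFinset with hF
  have hcount : ∀ S, descentCount G S m =
      ∑ w ∈ F, if ∀ i ∈ S, (system G).IsLeftDescent w i then 1 else 0 := by
    intro S
    rw [Finset.sum_boole, descentCount, ← Set.ncard_coe_finset]
    congr 2
    ext w
    simp [descentSet, hF]
  have hw : ∀ w ∈ F, ∑ S ∈ indepSubsets G m.support,
      (-1 : ℂ) ^ S.card * (if ∀ i ∈ S, (system G).IsLeftDescent w i then 1 else 0) =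
      if w = 1 then 1 else 0 := by
    intro w hw
    have hdeg : degree G w = m := by simpa [hF] using hw
    have h1 : ∑ S ∈ indepSubsets G m.support,
        (-1 : ℂ) ^ S.card * (if ∀ i ∈ S, (system G).IsLeftDescent w i then 1 else 0) =
        ∑ S ∈ (m.support.filter fun i => (system G).IsLeftDescent w i).powerset,
          (-1 : ℂ) ^ S.card := by
      simp only [mul_ite, mul_one, mul_zero]
      rw [← Finset.sum_filter, indepSubsets, Finset.filter_filter]
      apply Finset.sum_congr _ fun _ _ => rfl
      ext S
      simp only [Finset.mem_filter, Finset.mem_powerset, Finset.subset_iff]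
      constructor
      · exact fun h i hi => ⟨h.1 hi, h.2.2 i hi⟩
      · exact fun h => ⟨fun i hi => (h hi).1, fun i hi k hk _ =>
          not_adj_of_isLeftDescent G (h hi).2 (h hk).2, fun i hi => (h hi).2⟩
    have h2 : (m.support.filter fun i => (system G).IsLeftDescent w i) = ∅ ↔ w = 1 := by
      constructor
      · intro h
        by_contra hne
        obtain ⟨i, hi⟩ := (system G).exists_leftDescent_of_ne_one hne
        have hmem : i ∈ (m.support.filter fun i => (system G).IsLeftDescent w i) := by
          simpa [← hdeg, hi] using degree_apply_ne_zero G hi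
        simp [h] at hmem
      · rintro rfl
        simp [CoxeterSystem.not_isLeftDescent_one]
    rw [h1]
    have h3 := Finset.sum_powerset_neg_one_pow_card
      (x := m.support.filter fun i => (system G).IsLeftDescent w i)
    have h4 := congrArg (Int.cast : ℤ → ℂ) h3
    push_cast at h4
    rw [h4]
    simp only [h2]
  calc _ = ∑ w ∈ F, if w = 1 then (1 : ℂ) else 0 := by
        rw [← Finset.sum_congr rfl hw, Finset.sum_comm]
        exact Finset.sum_congr rfl fun S _ => by rw [hcount, Finset.mul_sum]
    _ = _ := by
        rw [Finset.sum_ite_eq']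
        simp [hF, degree_one, eq_comm]

/-- Uniqueness of the solution of the linear recursion satisfied by `descentCount`. -/
theorem eq_of_recursion [DecidableEq I] {f g : Finset I → (I →₀ ℕ) → ℂ}
    (hf : ∀ S m, ∀ i ∈ S, m i = 0 → f S m = 0) (hg : ∀ S m, ∀ i ∈ S, m i = 0 → g S m = 0)
    (hf' : ∀ S m, ∀ i ∉ S, G.IsIndepSet (insert i S : Finset I) →
      f (insert i S) (m + Finsupp.single i 1) + f (insert i S) m = f S m)
    (hg' : ∀ S m, ∀ i ∉ S, G.IsIndepSet (insert i S : Finset I) →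
      g (insert i S) (m + Finsupp.single i 1) + g (insert i S) m = g S m)
    (h : ∀ m, ∑ S ∈ indepSubsets G m.support,
        (-1 : ℂ) ^ S.card * f S m =
      ∑ S ∈ indepSubsets G m.support,
        (-1 : ℂ) ^ S.card * g S m)
    (m : I →₀ ℕ) : ∀ S : Finset I, G.IsIndepSet (S : Set I) → f S m = g S m := by
  induction hd : m.degree using Nat.strong_induction_on generalizing m with
  | _ d ih =>
  -- For nonempty `S` the recursion expresses the value at `m` by values of smaller degree, or the
  -- boundary condition applies.
  have hne : ∀ S : Finset I, S.Nonempty → G.IsIndepSet (S : Set I) → f S m = g S m := by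
    rintro S ⟨i, hi⟩ hS
    by_cases hm : m i = 0
    · rw [hf S m i hi hm, hg S m i hi hm]
    · obtain ⟨m', rfl⟩ : ∃ m', m = m' + Finsupp.single i 1 :=
        ⟨m - Finsupp.single i 1, (tsub_add_cancel_of_le (by
          simpa [Nat.one_le_iff_ne_zero] using hm)).symm⟩
      have hlt : m'.degree < d := by rw [← hd]; simp
      have h1 := hf' (S.erase i) m' i (by simp) (by rwa [Finset.insert_erase hi])
      have h2 := hg' (S.erase i) m' i (by simp) (by rwa [Finset.insert_erase hi])
      rw [Finset.insert_erase hi] at h1 h2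
      have h3 := ih _ hlt m' rfl S hS
      have h4 := ih _ hlt m' rfl (S.erase i) (hS.mono (by simp))
      linear_combination h1 - h2 - h3 + h4
  intro S hS
  rcases S.eq_empty_or_nonempty with rfl | hSn
  -- The alternating sum determines the term at `∅` once all the other terms are known.
  · have h0 : ∅ ∈ indepSubsets G m.support := by
      simp [mem_indepSubsets, SimpleGraph.IsIndepSet]
    have hm := h m
    have hsum : ∑ S ∈ (indepSubsets G m.support).erase ∅, (-1 : ℂ) ^ S.card * f S m =
        ∑ S ∈ (indepSubsets G m.support).erase ∅, (-1 : ℂ) ^ S.card * g S m := by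
      refine Finset.sum_congr rfl fun S hS => ?_
      rw [Finset.mem_erase, mem_indepSubsets] at hS
      rw [hne S (Finset.nonempty_iff_ne_empty.mpr hS.1) hS.2.2]
    rw [← Finset.add_sum_erase _ _ h0, ← Finset.add_sum_erase (a := ∅) _
        (fun S => (-1 : ℂ) ^ S.card * g S m) h0, hsum] at hm
    simpa using hm
  · exact hne S hSn hS

end DescentCount

/-! ### The product of binomial coefficients of a perfect elimination ordering -/

section BinomialProduct

variable {I : Type*} [LinearOrder I] {G : SimpleGraph I}

/-- `∏_{j ∈ A} binom(∑_{i ∈ A ∩ G_j} n_i, n_j)`. -/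
noncomputable def binomialProduct (hG : IsPerfectEliminationOrdering G) (A : Finset I)
    (n : I → ℕ) : ℂ :=
  ∏ j ∈ A, ((∑ i ∈ A with i ∈ (hG.finite j).toFinset, n i).choose (n j) : ℂ)

/-- The value of `binomialProduct` at `n` lowered by one on `S`, if this is possible. -/
noncomputable def loweredBinomialProduct (hG : IsPerfectEliminationOrdering G) (A S : Finset I)
    (n : I → ℕ) : ℂ :=
  if ∀ i ∈ S, n i ≠ 0 then binomialProduct hG A fun i => n i - if i ∈ S then 1 else 0 else 0

theorem mem_earlier_iff {i j : I} : i ∈ earlier G j ↔ (G.Adj i j ∧ i < j) ∨ i = j := by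
  simp [earlier, or_comm]

/-- A vertex `j` beyond all of `A` lies in no `G_k` with `k ∈ A`, so the old factors do not change.
-/
theorem binomialProduct_insert (hG : IsPerfectEliminationOrdering G) {A : Finset I} {j : I}
    (hj : ∀ i ∈ A, i < j) (n : I → ℕ) :
    binomialProduct hG (insert j A) n =
      ((∑ i ∈ insert j A with i ∈ (hG.finite j).toFinset, n i).choose (n j) : ℂ) *
        binomialProduct hG A n := by
  have hjA : j ∉ A := fun h => (hj j h).false
  rw [binomialProduct, Finset.prod_insert hjA, binomialProduct]
  congr 1
  refine Finset.prod_congr rfl fun k hk => ?_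
  have : j ∉ (hG.finite k).toFinset := by
    rw [Set.Finite.mem_toFinset, mem_earlier_iff]
    rintro (h | h)
    · exact (h.2.trans (hj k hk)).false
    · exact hjA (h ▸ hk)
  rw [Finset.filter_insert, if_neg this]

theorem binomialProduct_congr (hG : IsPerfectEliminationOrdering G) {A : Finset I} {n n' : I → ℕ}
    (h : ∀ i ∈ A, n i = n' i) : binomialProduct hG A n = binomialProduct hG A n' := by
  refine Finset.prod_congr rfl fun j hj => ?_
  rw [h j hj, Finset.sum_congr rfl fun i hi => h i (Finset.mem_filter.mp hi).1]

theorem sum_lowered_add_card {A S : Finset I} {n : I → ℕ} (hn : ∀ i ∈ S, n i ≠ 0) :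
    ∑ i ∈ A, (n i - if i ∈ S then 1 else 0) + (A.filter (· ∈ S)).card = ∑ i ∈ A, n i := by
  rw [Finset.card_filter, ← Finset.sum_add_distrib]
  refine Finset.sum_congr rfl fun i _ => ?_
  split_ifs with h
  · have := hn i h
    lia
  · rfl

theorem indepSubsets_insert (G : SimpleGraph I) {A : Finset I} {j : I} (hj : j ∉ A)
    (f : Finset I → ℂ) [DecidableRel G.Adj] :
    ∑ S ∈ indepSubsets G (insert j A), f S = ∑ S ∈ indepSubsets G A,
      (f S + if ∀ i ∈ S, ¬ G.Adj i j then f (insert j S) else 0) := by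
  rw [Finset.sum_add_distrib, ← Finset.sum_filter]
  have h1 : indepSubsets G (insert j A) = indepSubsets G A ∪
      ((indepSubsets G A).filter fun S => ∀ i ∈ S, ¬ G.Adj i j).image (insert j) := by
    ext S
    simp only [mem_indepSubsets, Finset.mem_union, Finset.mem_image, Finset.mem_filter]
    constructor
    · rintro ⟨hS, hi⟩
      by_cases hjS : j ∈ S
      · refine Or.inr ⟨S.erase j, ⟨⟨?_, hi.mono (by simp)⟩, ?_⟩, Finset.insert_erase hjS⟩
        · rwa [← Finset.subset_insert_iff]
        · intro i h
          rw [Finset.mem_erase] at h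
          exact hi h.2 hjS h.1
      · exact Or.inl ⟨(Finset.subset_insert_iff_of_notMem hjS).mp hS, hi⟩
    · rintro (⟨hS, hi⟩ | ⟨T, ⟨⟨hT, hi⟩, hadj⟩, rfl⟩)
      · exact ⟨hS.trans (Finset.subset_insert _ _), hi⟩
      · refine ⟨Finset.insert_subset_insert _ hT, ?_⟩
        rw [Finset.coe_insert, SimpleGraph.IsIndepSet, Set.pairwise_insert]
        exact ⟨hi, fun b hb _ => ⟨fun h => hadj b hb h.symm, hadj b hb⟩⟩
  rw [h1, Finset.sum_union, Finset.sum_image]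
  · intro S hS T hT h
    have hS' : j ∉ S := fun h => hj ((mem_indepSubsets G).mp (Finset.mem_filter.mp hS).1 |>.1 h)
    have hT' : j ∉ T := fun h => hj ((mem_indepSubsets G).mp (Finset.mem_filter.mp hT).1 |>.1 h)
    rw [← Finset.erase_insert hS', ← Finset.erase_insert hT']
    exact congrArg (fun U => Finset.erase U j) h
  · rw [Finset.disjoint_left]
    intro S hS hS'
    obtain ⟨T, -, rfl⟩ := Finset.mem_image.mp hS'
    exact hj (((mem_indepSubsets G).mp hS).1 (Finset.mem_insert_self _ _))

/-- The point is that the factor on the right does not depend on `S`. Let `N` be the sum of the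
`n_i` over `G_j`. If `S` contains a neighbour of `j`, only the first term is present, with top entry
`N - 1`. Otherwise, for `n_j ≠ 0`, the factor is `binom(N, n_j) - binom(N - 1, n_j - 1) = binom(N -
1, n_j)`; for `n_j = 0` the second term vanishes and the factor is 1. -/
theorem loweredBinomialProduct_insert (hG : IsPerfectEliminationOrdering G) {A : Finset I} {j : I}
    (hj : ∀ i ∈ A, i < j) (n : I → ℕ) [DecidableRel G.Adj] {S : Finset I}
    (hS : S ∈ indepSubsets G A) :
    (-1 : ℂ) ^ S.card * loweredBinomialProduct hG (insert j A) S n +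
      (if ∀ i ∈ S, ¬ G.Adj i j then
        (-1 : ℂ) ^ (insert j S).card * loweredBinomialProduct hG (insert j A) (insert j S) n
        else 0) =
      (if n j = 0 then 1 else
        (((∑ i ∈ insert j A with i ∈ (hG.finite j).toFinset, n i) - 1).choose (n j) : ℂ)) *
        ((-1 : ℂ) ^ S.card * loweredBinomialProduct hG A S n) := by
  obtain ⟨hSA, hSi⟩ := (mem_indepSubsets G).mp hS
  have hjA : j ∉ A := fun h => (hj j h).false
  have hjS : j ∉ S := fun h => hjA (hSA h)
  by_cases hn : ∀ i ∈ S, n i ≠ 0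
  swap
  · have hn' : ¬ ∀ i ∈ insert j S, n i ≠ 0 := fun h => hn fun i hi => h i (by simp [hi])
    have h0 : ∀ B T, (¬ ∀ i ∈ T, n i ≠ 0) → loweredBinomialProduct hG B T n = 0 :=
      fun B T hT => if_neg hT
    simp [h0 _ _ hn, h0 _ _ hn']
  set B := (insert j A).filter (· ∈ (hG.finite j).toFinset) with hB
  have hmemB : ∀ i, i ∈ B → i = j ∨ (i ∈ A ∧ G.Adj i j) := by
    intro i hi
    simp only [hB, Finset.mem_filter, Finset.mem_insert, Set.Finite.mem_toFinset,
      mem_earlier_iff] at hi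
    tauto
  have hmemB' : ∀ i ∈ A, G.Adj i j → i ∈ B := by
    intro i hi hadj
    simp [hB, mem_earlier_iff, hi, hadj, hj i hi]
  have hjB : j ∈ B := by simp [hB, mem_earlier_iff]
  have hcard := sum_lowered_add_card (A := B) hn
  -- A clique and an independent set share at most one vertex.
  have hle : (B.filter (· ∈ S)).card ≤ 1 := by
    rw [Finset.card_le_one]
    intro a ha b hb
    rw [Finset.mem_filter] at ha hb
    by_contra hab
    refine hSi ha.2 hb.2 hab (hG.isClique j ?_ ?_ hab)
    · simpa [hB] using (Finset.mem_filter.mp ha.1).2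
    · simpa [hB] using (Finset.mem_filter.mp hb.1).2
  have hfirst : loweredBinomialProduct hG (insert j A) S n =
      ((∑ i ∈ B, (n i - if i ∈ S then 1 else 0)).choose (n j) : ℂ) *
        loweredBinomialProduct hG A S n := by
    rw [loweredBinomialProduct, if_pos hn, binomialProduct_insert hG hj, loweredBinomialProduct,
      if_pos hn]
    simp [hjS, hB]
  by_cases hadj : ∀ i ∈ S, ¬ G.Adj i j
  · have hempty : B.filter (· ∈ S) = ∅ := by
      rw [Finset.filter_eq_empty_iff]
      intro i hi hiS
      rcases hmemB i hi with rfl | h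
      · exact hjS hiS
      · exact hadj i hiS h.2
    rw [hempty, Finset.card_empty, add_zero] at hcard
    rw [if_pos hadj, hfirst, hcard, Finset.card_insert_of_notMem hjS]
    by_cases hnj : n j = 0
    · have hn' : ¬ ∀ i ∈ insert j S, n i ≠ 0 := fun h => h j (by simp) hnj
      rw [loweredBinomialProduct.eq_def hG (insert j A) (insert j S), if_neg hn']
      simp [hnj]
    · have hn' : ∀ i ∈ insert j S, n i ≠ 0 := by
        rw [Finset.forall_mem_insert]
        exact ⟨hnj, hn⟩
      have hcard' := sum_lowered_add_card (A := B) hn'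
      have hone : B.filter (· ∈ insert j S) = {j} := by
        ext i
        simp only [Finset.mem_filter, Finset.mem_insert, Finset.mem_singleton]
        refine ⟨?_, by rintro rfl; exact ⟨hjB, Or.inl rfl⟩⟩
        rintro ⟨hi, rfl | hiS⟩
        · rfl
        · have := Finset.filter_eq_empty_iff.mp hempty hi
          exact absurd hiS this
      rw [hone, Finset.card_singleton] at hcard'
      have hsecond : loweredBinomialProduct hG (insert j A) (insert j S) n =
          ((∑ i ∈ B, (n i - if i ∈ insert j S then 1 else 0)).choose (n j - 1) : ℂ) *
            loweredBinomialProduct hG A S n := by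
        rw [loweredBinomialProduct, if_pos hn', binomialProduct_insert hG hj,
          loweredBinomialProduct, if_pos hn]
        congr 1
        · simp [hB]
        · refine binomialProduct_congr hG fun i hi => ?_
          have : i ≠ j := fun h => hjA (h ▸ hi)
          simp [this]
      rw [hsecond, if_neg hnj, ← hcard', Nat.add_sub_cancel]
      obtain ⟨p, hp⟩ := Nat.exists_eq_succ_of_ne_zero hnj
      rw [hp, Nat.succ_sub_one, Nat.choose_succ_succ]
      push_cast
      ring
  · rw [if_neg hadj, add_zero, hfirst]
    push Not at hadj
    obtain ⟨i, hiS, hadji⟩ := hadj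
    have hpos : 0 < (B.filter (· ∈ S)).card :=
      Finset.card_pos.mpr ⟨i, Finset.mem_filter.mpr ⟨hmemB' i (hSA hiS) hadji, hiS⟩⟩
    have h1 : ∑ i ∈ B, (n i - if i ∈ S then 1 else 0) = ∑ i ∈ B, n i - 1 := by
      have : (B.filter (· ∈ S)).card = 1 := le_antisymm hle hpos
      rw [← hcard, this, Nat.add_sub_cancel]
    rw [h1]
    split_ifs with hnj
    · simp [hnj]
    · ring

/-- This is `(∑_S (-1)^|S| y^S) B(y) = 1`, read off at `y^n` on the vertices `A`. Removing the
largest vertex splits off a common factor, so the induction hypothesis applies. -/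
theorem sum_neg_one_pow_loweredBinomialProduct (hG : IsPerfectEliminationOrdering G)
    (A : Finset I) (n : I → ℕ) :
    ∑ S ∈ indepSubsets G A, (-1 : ℂ) ^ S.card * loweredBinomialProduct hG A S n =
      if ∀ i ∈ A, n i = 0 then 1 else 0 := by
  classical
  induction A using Finset.induction_on_max with
  | empty =>
    have : indepSubsets G ∅ = {∅} := by
      ext S
      simp +contextual [mem_indepSubsets, SimpleGraph.IsIndepSet]
    simp [this, loweredBinomialProduct, binomialProduct]
  | insert j A hj ih =>
    have hjA : j ∉ A := fun h => (hj j h).false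
    rw [indepSubsets_insert G hjA, Finset.sum_congr rfl fun S hS =>
      loweredBinomialProduct_insert hG hj n hS, ← Finset.mul_sum, ih]
    by_cases hA : ∀ i ∈ A, n i = 0
    -- With `n = 0` on `A` the factor for `n_j ≠ 0` is `binom(n_j - 1, n_j) = 0`.
    · have hN : ∑ i ∈ insert j A with i ∈ (hG.finite j).toFinset, n i = n j := by
        rw [Finset.sum_eq_single_of_mem j (by simp [mem_earlier_iff])]
        intro i hi hij
        exact hA i (Finset.mem_of_mem_insert_of_ne (Finset.mem_filter.mp hi).1 hij)
      rw [hN, if_pos hA, mul_one]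
      simp only [Finset.forall_mem_insert]
      by_cases hnj : n j = 0
      · simpa [hnj] using hA
      · rw [if_neg hnj, if_neg fun h => hnj h.1, Nat.choose_eq_zero_of_lt (by lia), Nat.cast_zero]
    · rw [if_neg hA, if_neg fun h : ∀ i ∈ insert j A, n i = 0 =>
        hA fun i hi => h i (by simp [hi]), mul_zero]

end BinomialProduct

/-! ### Weighted sums over partitions -/

section Partitions

/-- The number of orderings of a multiset. -/
noncomputable def orderings (s : Multiset ℕ) : ℂ :=
  (s.card.factorial : ℂ) / ((∏ k ∈ s.toFinset, (s.count k).factorial : ℕ) : ℂ)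

theorem prod_count_factorial_erase {s : Multiset ℕ} {a : ℕ} (ha : a ∈ s) :
    ∏ k ∈ s.toFinset, (s.count k).factorial =
      s.count a * ∏ k ∈ (s.erase a).toFinset, ((s.erase a).count k).factorial := by
  have h1 : ∏ k ∈ (s.erase a).toFinset, ((s.erase a).count k).factorial =
      ∏ k ∈ s.toFinset, ((s.erase a).count k).factorial := by
    refine Finset.prod_subset (Multiset.toFinset_subset.mpr (Multiset.erase_subset a s)) ?_
    intro k _ hk
    rw [Multiset.mem_toFinset] at hk
    simp [Multiset.count_eq_zero_of_notMem hk]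
  have ha' : a ∈ s.toFinset := by simpa using ha
  rw [h1, ← Finset.mul_prod_erase _ _ ha', ← Finset.mul_prod_erase _ (fun k =>
    ((s.erase a).count k).factorial) ha', ← mul_assoc, Multiset.count_erase_self,
    Nat.mul_factorial_pred (Multiset.count_pos.mpr ha).ne']
  congr 1
  refine Finset.prod_congr rfl fun k hk => ?_
  rw [Multiset.count_erase_of_ne (Finset.mem_erase.mp hk).1]

/-- Orderings are sorted by their first entry `a`; numerically, the multiplicities add up to the
cardinality. -/
theorem orderings_eq_sum_erase {s : Multiset ℕ} (hs : s ≠ 0) :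
    orderings s = ∑ a ∈ s.toFinset, orderings (s.erase a) := by
  have h : ∀ a ∈ s.toFinset, orderings (s.erase a) =
      (s.count a : ℂ) * (((s.card - 1).factorial : ℂ) /
        ((∏ k ∈ s.toFinset, (s.count k).factorial : ℕ) : ℂ)) := by
    intro a ha
    rw [Multiset.mem_toFinset] at ha
    have hc : (s.count a : ℂ) ≠ 0 := Nat.cast_ne_zero.mpr (Multiset.count_pos.mpr ha).ne'
    rw [orderings, prod_count_factorial_erase ha, Multiset.card_erase_of_mem ha, Nat.cast_mul,
      Nat.pred_eq_sub_one, mul_div_assoc', mul_div_mul_left _ _ hc]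
  rw [Finset.sum_congr rfl h, ← Finset.sum_mul, ← Nat.cast_sum, Multiset.toFinset_sum_count_eq,
    mul_div_assoc', ← Nat.cast_mul, Nat.mul_factorial_pred (Multiset.card_pos.mpr hs).ne',
    orderings]

theorem factorial_div_multFactorial {n : ℕ} (p : Nat.Partition n) :
    ((length p).factorial : ℂ) / (multFactorial p : ℂ) = orderings p.parts := by
  rw [orderings, length, multFactorial]
  congr 2
  refine (Finset.prod_subset ?_ ?_).symm
  · intro k hk
    rw [Multiset.mem_toFinset] at hk
    exact Finset.mem_Icc.mpr ⟨p.parts_pos hk, p.le_of_mem_parts hk⟩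
  · intro k _ hk
    rw [Multiset.mem_toFinset] at hk
    simp [Multiset.count_eq_zero_of_notMem hk]

/-- The multisets of positive numbers with a given sum and cardinality. -/
def partsOfLength (n l : ℕ) : Finset (Multiset ℕ) :=
  ((Finset.univ : Finset (Nat.Partition n)).filter (length · = l)).image Nat.Partition.parts

theorem mem_partsOfLength {n l : ℕ} {s : Multiset ℕ} :
    s ∈ partsOfLength n l ↔ s.sum = n ∧ s.card = l ∧ ∀ k ∈ s, 0 < k := by
  simp only [partsOfLength, Finset.mem_image, Finset.mem_filter, Finset.mem_univ, true_and]
  constructor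
  · rintro ⟨p, hp, rfl⟩
    exact ⟨p.parts_sum, hp, fun k hk => p.parts_pos hk⟩
  · rintro ⟨h1, h2, h3⟩
    exact ⟨⟨s, fun {k} hk => h3 k hk, h1⟩, h2, rfl⟩

/-- The number of compositions of `n` into `l` parts. -/
noncomputable def compositionCount (n l : ℕ) : ℂ := ∑ s ∈ partsOfLength n l, orderings s

theorem compositionCount_eq (n l : ℕ) : compositionCount n l =
    ∑ p : Nat.Partition n with length p = l,
      ((length p).factorial : ℂ) / (multFactorial p : ℂ) := by
  rw [compositionCount, partsOfLength, Finset.sum_image fun p _ q _ h => Nat.Partition.ext h]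
  exact Finset.sum_congr rfl fun p _ => (factorial_div_multFactorial p).symm

/-- Removing the first part `a ≥ 1` of a composition of `n` leaves a composition of `b = n - a < n`.
-/
theorem compositionCount_succ (n l : ℕ) :
    compositionCount n (l + 1) = ∑ b ∈ Finset.range n, compositionCount b l := by
  have h : ∀ s ∈ partsOfLength n (l + 1),
      orderings s = ∑ a ∈ s.toFinset, orderings (s.erase a) := by
    intro s hs
    refine orderings_eq_sum_erase ?_
    rintro rfl
    simpa using (mem_partsOfLength.mp hs).2.1
  rw [compositionCount, Finset.sum_congr rfl h]
  simp only [compositionCount]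
  rw [Finset.sum_sigma', Finset.sum_sigma']
  refine Finset.sum_bij' (fun x _ => ⟨n - x.2, x.1.erase x.2⟩)
    (fun y _ => ⟨(n - y.1) ::ₘ y.2, n - y.1⟩) ?_ ?_ ?_ ?_ ?_
  · rintro ⟨s, a⟩ hx
    simp only [Finset.mem_sigma, mem_partsOfLength, Multiset.mem_toFinset, Finset.mem_range] at hx ⊢
    obtain ⟨⟨hsum, hcard, hpos⟩, ha⟩ := hx
    have h1 := Multiset.sum_erase ha
    have h2 := hpos a ha
    refine ⟨by lia, by lia, ?_, fun k hk => hpos k (Multiset.mem_of_mem_erase hk)⟩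
    rw [Multiset.card_erase_of_mem ha, hcard, Nat.pred_succ]
  · rintro ⟨b, t⟩ hy
    simp only [Finset.mem_sigma, mem_partsOfLength, Multiset.mem_toFinset, Finset.mem_range] at hy ⊢
    obtain ⟨hb, hsum, hcard, hpos⟩ := hy
    refine ⟨⟨?_, by simp [hcard], ?_⟩, by simp⟩
    · rw [Multiset.sum_cons]
      lia
    · intro k hk
      rcases Multiset.mem_cons.mp hk with rfl | hk
      · lia
      · exact hpos k hk
  · rintro ⟨s, a⟩ hx
    simp only [Finset.mem_sigma, mem_partsOfLength, Multiset.mem_toFinset] at hx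
    obtain ⟨⟨hsum, hcard, hpos⟩, ha⟩ := hx
    have h1 := Multiset.sum_erase ha
    have h3 : n - (n - a) = a := by lia
    simp only [h3, Multiset.cons_erase ha]
  · rintro ⟨b, t⟩ hy
    simp only [Finset.mem_sigma, Finset.mem_range] at hy
    have h3 : n - (n - b) = b := by lia
    simp only [h3, Multiset.erase_cons_head]
  · rintro ⟨s, a⟩ _
    rfl

theorem compositionCount_succ_succ (n l : ℕ) :
    compositionCount (n + 1) (l + 1) = compositionCount n (l + 1) + compositionCount n l := by
  rw [compositionCount_succ, Finset.sum_range_succ, ← compositionCount_succ]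

theorem compositionCount_zero_right (n : ℕ) :
    compositionCount n 0 = if n = 0 then 1 else 0 := by
  have : partsOfLength n 0 = if n = 0 then {0} else ∅ := by
    ext s
    rw [mem_partsOfLength, Multiset.card_eq_zero]
    split_ifs with h
    · simp only [Finset.mem_singleton]
      exact ⟨fun h => h.2.1, by rintro rfl; simp [h]⟩
    · simp only [Finset.notMem_empty, iff_false]
      rintro ⟨h1, rfl, -⟩
      exact h (by simpa using h1.symm)
  rw [compositionCount, this]
  split_ifs <;> simp [orderings]

theorem compositionCount_eq_zero {n l : ℕ} (h : n < l) : compositionCount n l = 0 := by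
  induction l generalizing n with
  | zero => simp at h
  | succ l ih =>
    rw [compositionCount_succ]
    exact Finset.sum_eq_zero fun b hb => ih (by rw [Finset.mem_range] at hb; lia)

/-- The coefficient of `x ^ n` in `(x / (1 + x)) ^ l`. -/
noncomputable def signedCount (n l : ℕ) : ℂ := (-1) ^ (n + l) * compositionCount n l

/-- The coefficient form of `(1 + x) y^(l+1) = x y^l` for `y = x / (1 + x)`. -/
theorem signedCount_succ_add (n l : ℕ) :
    signedCount (n + 1) (l + 1) + signedCount n (l + 1) = signedCount n l := by
  rw [signedCount, signedCount, signedCount, compositionCount_succ_succ]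
  ring

theorem signedCount_zero_right (n : ℕ) : signedCount n 0 = if n = 0 then 1 else 0 := by
  rw [signedCount, compositionCount_zero_right]
  split_ifs with h <;> simp [h]

theorem signedCount_eq_zero {n l : ℕ} (h : n < l) : signedCount n l = 0 := by
  rw [signedCount, compositionCount_eq_zero h, mul_zero]

theorem signedCount_eq (n l : ℕ) : signedCount n l =
    ∑ p : Nat.Partition n with length p = l,
      (-1 : ℂ) ^ (n + length p) * (((length p).factorial : ℂ) / (multFactorial p : ℂ)) := by
  rw [signedCount, compositionCount_eq, Finset.mul_sum]
  refine Finset.sum_congr rfl fun p hp => ?_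
  rw [(Finset.mem_filter.mp hp).2]

end Partitions

/-! ### The substitution `x ↦ x / (1 + x)` -/

section Substitution

variable {I : Type*} [DecidableEq I]

/-- The coefficient of `x ^ m` in `∏ (x_i / (1 + x_i)) ^ n_i`. -/
noncomputable def substCoeff (m n : I →₀ ℕ) : ℂ :=
  ∏ j ∈ m.support ∪ n.support, signedCount (m j) (n j)

theorem substCoeff_eq_prod {m n : I →₀ ℕ} {A : Finset I} (hm : m.support ⊆ A)
    (hn : n.support ⊆ A) : substCoeff m n = ∏ j ∈ A, signedCount (m j) (n j) := by
  refine Finset.prod_subset (Finset.union_subset hm hn) fun j _ hj => ?_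
  simp only [Finset.mem_union, Finsupp.mem_support_iff, not_or, not_not] at hj
  rw [hj.1, hj.2, signedCount_zero_right, if_pos rfl]

theorem substCoeff_eq_zero {m n : I →₀ ℕ} (h : ¬ n ≤ m) : substCoeff m n = 0 := by
  rw [Finsupp.le_def, not_forall] at h
  obtain ⟨j, hj⟩ := h
  refine Finset.prod_eq_zero (i := j) ?_ (signedCount_eq_zero (by lia))
  simp only [Finset.mem_union, Finsupp.mem_support_iff]
  lia

theorem substCoeff_zero_right (m : I →₀ ℕ) : substCoeff m 0 = if m = 0 then 1 else 0 := by
  split_ifs with h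
  · simp [h, substCoeff]
  · obtain ⟨j, hj⟩ := Finsupp.ne_iff.mp h
    refine Finset.prod_eq_zero (i := j) (by simpa using hj) ?_
    rw [Finsupp.zero_apply, signedCount_zero_right, if_neg (by simpa using hj)]

theorem substCoeff_add_single (m n : I →₀ ℕ) (i : I) :
    substCoeff (m + Finsupp.single i 1) (n + Finsupp.single i 1) +
      substCoeff m (n + Finsupp.single i 1) = substCoeff m n := by
  set A := insert i (m.support ∪ n.support) with hA
  have hm : m.support ⊆ A := fun j hj => by simp_all
  have hn : n.support ⊆ A := fun j hj => by simp_all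
  have hs : ∀ k : I →₀ ℕ, k.support ⊆ A → (k + Finsupp.single i 1).support ⊆ A := by
    intro k hk j hj
    by_cases hji : j = i
    · simp [hA, hji]
    · refine hk ?_
      simpa [Finsupp.single_apply, Ne.symm hji] using hj
  have hi : i ∈ A := by simp [hA]
  rw [substCoeff_eq_prod (hs m hm) (hs n hn), substCoeff_eq_prod hm (hs n hn),
    substCoeff_eq_prod hm hn, ← Finset.mul_prod_erase _ _ hi,
    ← Finset.mul_prod_erase _ (fun j => signedCount (m j)
      ((n + Finsupp.single i 1 : I →₀ ℕ) j)) hi,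
    ← Finset.mul_prod_erase _ (fun j => signedCount (m j) (n j)) hi]
  have h1 : ∀ k : I →₀ ℕ, ∀ j ∈ A.erase i, (k + Finsupp.single i 1 : I →₀ ℕ) j = k j := by
    intro k j hj
    simp [(Finset.ne_of_mem_erase hj).symm]
  have h2 : ∏ j ∈ A.erase i, signedCount ((m + Finsupp.single i 1 : I →₀ ℕ) j)
      ((n + Finsupp.single i 1 : I →₀ ℕ) j) = ∏ j ∈ A.erase i, signedCount (m j) (n j) :=
    Finset.prod_congr rfl fun j hj => by rw [h1 m j hj, h1 n j hj]
  have h3 : ∏ j ∈ A.erase i, signedCount (m j) ((n + Finsupp.single i 1 : I →₀ ℕ) j) =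
      ∏ j ∈ A.erase i, signedCount (m j) (n j) :=
    Finset.prod_congr rfl fun j hj => by rw [h1 n j hj]
  rw [h2, h3, ← add_mul]
  simp only [Finsupp.add_apply, Finsupp.single_eq_same]
  rw [signedCount_succ_add]

/-- The coefficient of `x ^ m` in `∑ F(n) ∏ (x_i / (1 + x_i)) ^ n_i`. -/
noncomputable def substitution (F : (I →₀ ℕ) → ℂ) (m : I →₀ ℕ) : ℂ :=
  ∑ n ∈ Finset.Iic m, substCoeff m n * F n

theorem subst_eq_sum_Iic (F : (I →₀ ℕ) → ℂ) {m M : I →₀ ℕ} (h : m ≤ M) :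
    substitution F m = ∑ n ∈ Finset.Iic M, substCoeff m n * F n := by
  refine Finset.sum_subset (Finset.Iic_subset_Iic.mpr h) fun n _ hn => ?_
  rw [substCoeff_eq_zero (by simpa using hn), zero_mul]

theorem sum_Iic_add_single {F F' : (I →₀ ℕ) → ℂ} {i : I}
    (h : ∀ n, F' (n + Finsupp.single i 1) = F n) (h0 : ∀ n, n i = 0 → F' n = 0)
    (g : (I →₀ ℕ) → ℂ) (m : I →₀ ℕ) :
    ∑ n ∈ Finset.Iic (m + Finsupp.single i 1), g n * F' n =
      ∑ n ∈ Finset.Iic m, g (n + Finsupp.single i 1) * F n := by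
  have h1 : ∑ n ∈ Finset.Iic m, g (n + Finsupp.single i 1) * F n =
      ∑ n ∈ (Finset.Iic m).map (addRightEmbedding (Finsupp.single i 1)), g n * F' n := by
    rw [Finset.sum_map]
    exact Finset.sum_congr rfl fun n _ => by rw [addRightEmbedding_apply, h]
  rw [h1]
  symm
  refine Finset.sum_subset ?_ ?_
  · intro n hn
    obtain ⟨k, hk, rfl⟩ := Finset.mem_map.mp hn
    rw [Finset.mem_Iic] at hk ⊢
    exact add_le_add_left hk _
  · intro n hn hn'
    by_cases hni : n i = 0
    · rw [h0 n hni, mul_zero]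
    · have hle : Finsupp.single i 1 ≤ n := by
        simpa [Nat.one_le_iff_ne_zero] using hni
      refine absurd (Finset.mem_map.mpr ⟨n - Finsupp.single i 1, ?_, ?_⟩) hn'
      · rw [Finset.mem_Iic] at hn ⊢
        exact tsub_le_iff_right.mpr hn
      · exact tsub_add_cancel_of_le hle

/-- The hypotheses say that `F'` is the coefficient family of `y_i` times that of `F`, and `(1 +
x_i) y_i = x_i`. This is the same recursion as in `descentCount_insert`. -/
theorem subst_add_single {F F' : (I →₀ ℕ) → ℂ} {i : I}
    (h : ∀ n, F' (n + Finsupp.single i 1) = F n) (h0 : ∀ n, n i = 0 → F' n = 0) (m : I →₀ ℕ) :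
    substitution F' (m + Finsupp.single i 1) + substitution F' m = substitution F m := by
  rw [subst_eq_sum_Iic F' (m := m) (M := m + Finsupp.single i 1) (by simp), substitution,
    sum_Iic_add_single h h0, sum_Iic_add_single h h0, ← Finset.sum_add_distrib, substitution]
  exact Finset.sum_congr rfl fun n _ => by rw [← add_mul, substCoeff_add_single]

end Substitution

/-! ### Lengths of tuples of partitions -/

section Lengths

theorem length_le {n : ℕ} (p : Nat.Partition n) : length p ≤ n := by
  have h := Multiset.card_nsmul_le_sum (s := p.parts) (a := 1) fun k hk => p.parts_pos hk
  rwa [p.parts_sum, smul_eq_mul, mul_one] at h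

variable {I : Type*}

/-- The lengths of the partitions in a tuple. -/
noncomputable def lengths {m : I →₀ ℕ} (l : PartitionTuple m) : I →₀ ℕ :=
  Finsupp.onFinset m.support (fun i => length (l i)) fun i hi => by
    rw [Finsupp.mem_support_iff]
    contrapose! hi
    exact Nat.le_zero.mp ((length_le (l i)).trans hi.le)

theorem lengths_apply {m : I →₀ ℕ} (l : PartitionTuple m) (i : I) : lengths l i = length (l i) :=
  rfl

theorem lengths_le {m : I →₀ ℕ} (l : PartitionTuple m) : lengths l ≤ m :=
  fun i => length_le (l i)

theorem lengths_eq_iff {m n : I →₀ ℕ} (h : n ≤ m) (l : PartitionTuple m) :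
    lengths l = n ↔ ∀ j ∈ m.support, length (l j) = n j := by
  refine ⟨by rintro rfl j _; rfl, fun hl => ?_⟩
  ext j
  by_cases hj : j ∈ m.support
  · exact hl j hj
  · have hm := Finsupp.notMem_support_iff.mp hj
    have h1 := lengths_le l j
    have h2 := h j
    lia

end Lengths

/-! ### The coefficients of the Hilbert series -/

section Coefficients

variable {I : Type*} [LinearOrder I] {G : SimpleGraph I}

theorem binomialProduct_eq (hG : IsPerfectEliminationOrdering G) {A : Finset I} {n : I →₀ ℕ}
    (h : n.support ⊆ A) : binomialProduct hG A n =
      ∏ j ∈ A, ((∑ i ∈ (hG.finite j).toFinset, n i).choose (n j) : ℂ) := by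
  refine Finset.prod_congr rfl fun j _ => ?_
  congr 2
  rw [Finset.filter_mem_eq_inter, Finset.inter_comm]
  refine Finset.sum_subset Finset.inter_subset_left fun i hi hi' => ?_
  by_contra hni
  exact hi' (Finset.mem_inter.mpr ⟨hi, h (Finsupp.mem_support_iff.mpr hni)⟩)

theorem binomialProduct_eq_support (hG : IsPerfectEliminationOrdering G) {A : Finset I}
    {n : I →₀ ℕ} (h : n.support ⊆ A) :
    binomialProduct hG A n = binomialProduct hG n.support n := by
  rw [binomialProduct_eq hG h, binomialProduct_eq hG subset_rfl]
  refine (Finset.prod_subset h fun j _ hj => ?_).symm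
  rw [Finsupp.notMem_support_iff.mp hj, Nat.choose_zero_right, Nat.cast_one]

/-- The coefficient at `x ^ n` of `x ^ S` times the series with coefficients
`∏_j binom(∑_{i ∈ G_j} n_i, n_j)`. -/
noncomputable def shiftedBinomialProduct (hG : IsPerfectEliminationOrdering G) (S : Finset I)
    (n : I →₀ ℕ) : ℂ :=
  if ∀ i ∈ S, n i ≠ 0 then
    binomialProduct hG (n - ∑ i ∈ S, Finsupp.single i 1).support
      (n - ∑ i ∈ S, Finsupp.single i 1 : I →₀ ℕ)
  else 0

theorem shiftedBinomialProduct_eq_zero (hG : IsPerfectEliminationOrdering G) {S : Finset I}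
    {n : I →₀ ℕ} {i : I} (hi : i ∈ S) (hn : n i = 0) : shiftedBinomialProduct hG S n = 0 :=
  if_neg fun h => h i hi hn

theorem shiftedBinomialProduct_insert (hG : IsPerfectEliminationOrdering G) {S : Finset I}
    {i : I} (hi : i ∉ S) (n : I →₀ ℕ) :
    shiftedBinomialProduct hG (insert i S) (n + Finsupp.single i 1) =
      shiftedBinomialProduct hG S n := by
  have h1 : (∀ k ∈ insert i S, (n + Finsupp.single i 1 : I →₀ ℕ) k ≠ 0) ↔ ∀ k ∈ S, n k ≠ 0 := by
    rw [Finset.forall_mem_insert]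
    simp only [Finsupp.add_apply, Finsupp.single_eq_same, ne_eq, Nat.add_eq_zero_iff, one_ne_zero,
      and_false, not_false_eq_true, true_and]
    refine forall₂_congr fun k hk => ?_
    have : i ≠ k := fun h => hi (h ▸ hk)
    simp [this]
  have h2 : n + Finsupp.single i 1 - ∑ k ∈ insert i S, Finsupp.single k 1 =
      n - ∑ k ∈ S, Finsupp.single k 1 := by
    rw [Finset.sum_insert hi, add_comm n, add_tsub_add_eq_tsub_left]
  rw [shiftedBinomialProduct, shiftedBinomialProduct, h2]
  simp only [h1]

/-- Vertices outside the support contribute factors `binom(_, 0) = 1`, so the product may be taken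
over a fixed finite `A`, as the induction on vertices requires. -/
theorem shiftedBinomialProduct_eq_lowered (hG : IsPerfectEliminationOrdering G) {A : Finset I}
    (S : Finset I) {n : I →₀ ℕ} (h : n.support ⊆ A) :
    shiftedBinomialProduct hG S n = loweredBinomialProduct hG A S n := by
  rw [shiftedBinomialProduct, loweredBinomialProduct]
  congr 1
  have hsub : (n - ∑ i ∈ S, Finsupp.single i 1).support ⊆ A :=
    (Finsupp.support_mono tsub_le_self).trans h
  rw [← binomialProduct_eq_support hG hsub]
  refine binomialProduct_congr hG fun i _ => ?_
  simp [Finsupp.single_apply]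

/-- The coefficients of the Hilbert series as a signed sum of products of binomial
coefficients. -/
theorem coeff_hilbertSeries_eq_subst (hG : IsPerfectEliminationOrdering G) (m : I →₀ ℕ) :
    MvPowerSeries.coeff m (hilbertSeries G) = substitution (shiftedBinomialProduct hG ∅) m := by
  classical
  rw [← descentCount_empty]
  refine eq_of_recursion G (f := descentCount G)
    (g := fun S => substitution (shiftedBinomialProduct hG S)) ?_ ?_ ?_ ?_ ?_ m ∅ (by
      simp [SimpleGraph.IsIndepSet])
  · exact fun S m i hi hm => descentCount_eq_zero G hi hm
  · intro S m i hi hm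
    refine Finset.sum_eq_zero fun n hn => ?_
    rw [shiftedBinomialProduct_eq_zero hG hi
      (Nat.le_zero.mp (hm ▸ Finset.mem_Iic.mp hn i)), mul_zero]
  · exact fun S m i hi hS => descentCount_insert G hi hS m
  · exact fun S m i hi _ => subst_add_single (shiftedBinomialProduct_insert hG hi)
      (fun n hn => shiftedBinomialProduct_eq_zero hG (Finset.mem_insert_self i S) hn) m
  · intro m
    rw [sum_neg_one_pow_descentCount]
    simp only [substitution, Finset.mul_sum]
    rw [Finset.sum_comm]
    -- Since `n ≤ m`, the single set `A = m.support` serves for every `n`, and only `n = 0`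
    -- survives.
    have h1 : ∀ n ∈ Finset.Iic m, ∑ S ∈ indepSubsets G m.support,
        (-1 : ℂ) ^ S.card * (substCoeff m n * shiftedBinomialProduct hG S n) =
        if n = 0 then substCoeff m n else 0 := by
      intro n hn
      have hsub : n.support ⊆ m.support := Finsupp.support_mono (Finset.mem_Iic.mp hn)
      have h2 : (∀ i ∈ m.support, n i = 0) ↔ n = 0 := by
        refine ⟨fun h => ?_, by rintro rfl; simp⟩
        ext i
        by_contra hi
        exact hi (h i (hsub (Finsupp.mem_support_iff.mpr hi)))
      simp only [shiftedBinomialProduct_eq_lowered hG _ hsub, mul_left_comm _ (substCoeff m n)]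
      rw [← Finset.mul_sum, sum_neg_one_pow_loweredBinomialProduct]
      simp only [h2, mul_ite, mul_one, mul_zero]
    rw [Finset.sum_congr rfl h1, Finset.sum_ite_eq', if_pos (by simp : (0 : I →₀ ℕ) ∈ Finset.Iic m),
      substCoeff_zero_right]
    congr

/-- Each factor is a sum over partitions of `m_j` of length `n_j`; expanding the product gives
tuples over the support of `m`, which extend uniquely because 0 has only one partition. -/
theorem substCoeff_eq_sum {m n : I →₀ ℕ} (h : n ≤ m) :
    substCoeff m n = ∑ l : PartitionTuple m with lengths l = n, ∏ j ∈ m.support,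
      (-1 : ℂ) ^ (m j + length (l j)) *
        (((length (l j)).factorial : ℂ) / (multFactorial (l j) : ℂ)) := by
  rw [substCoeff_eq_prod subset_rfl (Finsupp.support_mono h), ← Finset.prod_coe_sort]
  simp only [signedCount_eq]
  rw [Finset.prod_univ_sum]
  symm
  refine Finset.sum_nbij (fun l j => l j.1) ?_ ?_ ?_ ?_
  · intro l hl
    rw [Finset.mem_filter, lengths_eq_iff h] at hl
    simpa using fun j hj => hl.2 j (Finsupp.mem_support_iff.mpr hj)
  · intro l _ l' _ hll
    funext i
    by_cases hi : i ∈ m.support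
    · exact congrFun hll ⟨i, hi⟩
    · have : ∀ n : ℕ, n = 0 → ∀ p q : Nat.Partition n, p = q := by
        rintro n rfl p q
        exact Subsingleton.elim _ _
      exact this _ (Finsupp.notMem_support_iff.mp hi) _ _
  · intro x hx
    refine ⟨fun j => if hj : j ∈ m.support then x ⟨j, hj⟩ else Nat.Partition.indiscrete _,
      ?_, ?_⟩
    · rw [Finset.mem_coe, Finset.mem_filter, lengths_eq_iff h]
      refine ⟨Finset.mem_univ _, fun j hj => ?_⟩
      rw [dif_pos hj]
      have := Fintype.mem_piFinset.mp (Finset.mem_coe.mp hx) ⟨j, hj⟩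
      exact (Finset.mem_filter.mp this).2
    · funext j
      exact dif_pos j.2
  · intro l _
    exact (Finset.prod_coe_sort m.support fun j => (-1 : ℂ) ^ (m j + length (l j)) *
        (((length (l j)).factorial : ℂ) / (multFactorial (l j) : ℂ))).symm

end Coefficients

end RACG

theorem mainTheorem11 {I : Type*} [Countable I] [LinearOrder I] (G : SimpleGraph I)
    (hG : RACG.IsPerfectEliminationOrdering G) (m : I →₀ ℕ) :
    MvPowerSeries.coeff m (RACG.hilbertSeries G) =
      ∑ l : RACG.PartitionTuple m,
        (-1 : ℂ) ^ (m.degree + ∑ j ∈ m.support, RACG.length (l j)) *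
          ∏ j ∈ m.support,
            ((∑ i ∈ (hG.finite j).toFinset, RACG.length (l i)).choose (RACG.length (l j)) : ℂ) *
              (((RACG.length (l j)).factorial : ℂ) / (RACG.multFactorial (l j) : ℂ)) := by
  -- The tuples are grouped by their lengths `n`, on which the binomial factors depend; the
  -- remaining weights sum to `substCoeff m n`.
  rw [RACG.coeff_hilbertSeries_eq_subst hG, RACG.substitution,
    ← Finset.sum_fiberwise_of_maps_to (t := Finset.Iic m)
      fun l _ => Finset.mem_Iic.mpr (RACG.lengths_le l)]
  refine Finset.sum_congr rfl fun n hn => ?_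
  have hle : n ≤ m := Finset.mem_Iic.mp hn
  rw [RACG.substCoeff_eq_sum hle, Finset.sum_mul]
  refine Finset.sum_congr rfl fun l hl => ?_
  obtain rfl : RACG.lengths l = n := (Finset.mem_filter.mp hl).2
  have hsub : (RACG.lengths l).support ⊆ m.support := Finsupp.support_mono hle
  have h1 : RACG.shiftedBinomialProduct hG ∅ (RACG.lengths l) = ∏ j ∈ m.support,
      ((∑ i ∈ (hG.finite j).toFinset, RACG.length (l i)).choose (RACG.length (l j)) : ℂ) := by
    rw [RACG.shiftedBinomialProduct_eq_lowered hG ∅ hsub, RACG.loweredBinomialProduct,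
      if_pos (by simp)]
    rw [RACG.binomialProduct_congr hG (n' := RACG.lengths l) fun i _ => by simp,
      RACG.binomialProduct_eq hG hsub]
    simp only [RACG.lengths_apply]
  rw [h1, Finset.prod_mul_distrib, Finset.prod_mul_distrib, Finset.prod_pow_eq_pow_sum,
    Finset.sum_add_distrib, Finsupp.degree_apply]
  ring
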